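/- Let $L$ be a countable first-order language. A positive Horn formula is a first-order $L$-formula built from atomic formulas (including the propositional constant $\bot$ for falsehood) by conjunction, universal quantification and existential quantification. An $L$-structure $\mathfrak A$ is $\aleph_0$-categorical if it is countable (finite or countably infinite) and every countable $L$-structure satisfying the same first-order sentences as $\mathfrak A$ is isomorphic to $\mathfrak A$. For an $L$-structure $\mathfrak A$ with universe $A$, a function $\vec a:\mathbb N\to A$ is periodic if there is an integer $k>0$ such that $\vec a(i)=\vec a(i \bmod k)$ for all $i\in\mathbb N$; the periodic power $\mathfrak A^{\mathrm{per}}$ is the substructure, induced on the set of all periodic functions $\mathbb N\to A$, of the direct power $\mathfrak A^{\mathbb N}$, in which relation and function symbols are interpreted coordinatewise. Let $\mathfrak A$ and $\mathfrak B$ be $\aleph_0$-categorical $L$-structures such that every positive Horn sentence true in $\mathfrak A$ is true in $\mathfrak B$. Then there is a surjective homomorphism from $\mathfrak A^{\mathrm{per}}$ onto $\mathfrak B$. -/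

import Mathlib

open FirstOrder FirstOrder.Language

universe u v w w'

namespace PeriodicPower

/-- The direct product of a family of `L`-structures: relations and functions are interpreted
coordinatewise. For a constant family this is the power `A ^ I`. -/
instance piStructure (L : FirstOrder.Language.{u, v}) {I : Type w} (M : I → Type w')
    [∀ i, L.Structure (M i)] : L.Structure (∀ i, M i) where
  funMap f x := fun i => Structure.funMap f (fun j => x j i)
  RelMap R x := ∀ i, Structure.RelMap R (fun j => x j i)

/-- `a : ℕ → A` is `k`-periodic if `k > 0` and `a i = a (i mod k)` for all `i`. -/
def IsPeriodicWith {A : Type w} (a : ℕ → A) (k : ℕ) : Prop :=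
  0 < k ∧ ∀ i, a i = a (i % k)

/-- `a : ℕ → A` is periodic if it is `k`-periodic for some `k > 0`. -/
def IsPeriodic {A : Type w} (a : ℕ → A) : Prop :=
  ∃ k, IsPeriodicWith a k

theorem IsPeriodicWith.of_dvd {A : Type w} {a : ℕ → A} {k m : ℕ} (h : IsPeriodicWith a k)
    (hm : 0 < m) (hkm : k ∣ m) : IsPeriodicWith a m := by
  refine ⟨hm, fun i => ?_⟩
  rw [h.2 i, h.2 (i % m), Nat.mod_mod_of_dvd i hkm]

/-- The periodic power of the `L`-structure `A`: the substructure of `A ^ ℕ` whose universe is the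
set of all periodic functions. -/
def periodicPower (L : FirstOrder.Language.{u, v}) (A : Type w) [L.Structure A] :
    L.Substructure (ℕ → A) where
  carrier := {a | IsPeriodic a}
  fun_mem := by
    intro n f x hx
    choose k hk using hx
    refine ⟨∏ j, k j, Finset.prod_pos fun j _ => (hk j).1, fun i => ?_⟩
    have h : ∀ j, x j i = x j (i % ∏ j, k j) := fun j =>
      ((hk j).of_dvd (Finset.prod_pos fun j _ => (hk j).1)
        (Finset.dvd_prod_of_mem k (Finset.mem_univ j))).2 i
    change Structure.funMap f (fun j => x j i) =
      Structure.funMap f (fun j => x j (i % ∏ j, k j))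
    simp only [← h]

/-- A structure `A` is `ℵ₀`-categorical if it is countable (finite or countably infinite) and every
countable structure satisfying the same first-order sentences is isomorphic to `A`. (Every
countable structure has an isomorphic copy in the universe of `A`.) -/
def IsAleph0Categorical (L : FirstOrder.Language.{u, v}) (A : Type w) [L.Structure A] : Prop :=
  Countable A ∧ ∀ (C : Type w) [L.Structure C], Countable C →
    L.ElementarilyEquivalent A C → Nonempty (A ≃[L] C)

/-- Positive Horn formulas: built from atoms (including falsehood) by conjunction and the two
quantifiers. -/
inductive IsPositiveHorn {L : FirstOrder.Language.{u, v}} {α : Type w} :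
    ∀ {n : ℕ}, L.BoundedFormula α n → Prop
  | falsum {n : ℕ} : IsPositiveHorn (⊥ : L.BoundedFormula α n)
  | atomic {n : ℕ} {φ : L.BoundedFormula α n} (h : φ.IsAtomic) : IsPositiveHorn φ
  | inf {n : ℕ} {φ ψ : L.BoundedFormula α n} (hφ : IsPositiveHorn φ) (hψ : IsPositiveHorn ψ) :
      IsPositiveHorn (φ ⊓ ψ)
  | all {n : ℕ} {φ : L.BoundedFormula α (n + 1)} (h : IsPositiveHorn φ) : IsPositiveHorn φ.all
  | ex {n : ℕ} {φ : L.BoundedFormula α (n + 1)} (h : IsPositiveHorn φ) : IsPositiveHorn φ.ex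

/-- Every positive Horn sentence true in `A` is true in `B`. -/
def PositiveHornTransfer (L : FirstOrder.Language.{u, v}) (A : Type w) (B : Type w')
    [L.Structure A] [L.Structure B] : Prop :=
  ∀ φ : L.Sentence, IsPositiveHorn φ → A ⊨ φ → B ⊨ φ

end PeriodicPower

/-!
The homomorphism is built by back and forth. A finite part of it is a tuple `a` of periodic
sequences in `A` together with a tuple `b` in `B` such that every positive Horn formula true of `a`
at each coordinate is true of `b` (`Transfers`); for periodic sequences this says that positive Horn
formulas true of `a` in the periodic power are true of `b`, and for empty tuples it is the
hypothesis on sentences. What makes both extension steps work is that an `ℵ₀`-categorical structure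
has, up to equivalence, only finitely many formulas in `n` variables.

* Forth (`Transfers.exists_snoc_right`): given a new sequence, the positive Horn formulas that the
  new element of `B` has to satisfy amount to finitely many over `B`, hence to one conjunction,
  whose existential quantification is positive Horn and transfers.
* Back (`Transfers.exists_snoc_left`): given a new element of `B`, every positive Horn formula `φ`
  that fails there fails over `A` for some value `c` at some coordinate, since otherwise `∀ y, φ`
  would transfer. Up to equivalence in `A` there are finitely many such `φ`, and the periodicity of
  `a` leaves infinitely many equivalent coordinates, so a single periodic sequence falsifies each of
  them somewhere.

A generic ideal of finite parts (the Rasiowa-Sikorski lemma, `Order.idealOfCofinals`) then defines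
a total surjective map; it preserves atomic formulas, as these are positive Horn.

The finiteness is one half of the Ryll-Nardzewski theorem
(`IsAleph0Categorical.finite_definable`). If infinitely many sets of `n`-tuples were definable, some
ultrafilter on `Aⁿ` would give a non-isolated type. It is realized in one countable model of the
theory of `A` (`exists_realization_of_ultrafilter`) and omitted in another (`omitting_types`), which
contradicts categoricity. Both models are elementary substructures of ultrapowers of `A`; the
omitting one consists of the coordinate functions in an ultrapower by an ultrafilter on `ℕ → A`
that contains a generic family of definable cylinders.
-/

namespace PeriodicPower

/-! ### Definable cylinders of sequences -/

section Cylinders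

variable (L : FirstOrder.Language.{u, v}) {A : Type w} [L.Structure A]

/-- `S` is a set of sequences `ℕ → A` defined by a parameter-free formula in the first `N`
coordinates. -/
def IsCylinder (N : ℕ) (S : Set (ℕ → A)) : Prop :=
  ∃ D : Set (Fin N → A), (∅ : Set A).Definable L D ∧ S = (fun v => v ∘ Fin.val) ⁻¹' D

variable {L}

theorem isCylinder_preimage_comp {n N : ℕ} {t : Fin n → ℕ} (ht : ∀ j, t j < N)
    {D : Set (Fin n → A)} (hD : (∅ : Set A).Definable L D) :
    IsCylinder L N ((fun v : ℕ → A => v ∘ t) ⁻¹' D) :=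
  ⟨_, hD.preimage_comp (fun j => (⟨t j, ht j⟩ : Fin N)), rfl⟩

theorem IsCylinder.mono {N N' : ℕ} {S : Set (ℕ → A)} (h : IsCylinder L N S) (hN : N ≤ N') :
    IsCylinder L N' S := by
  obtain ⟨D, hD, rfl⟩ := h
  exact isCylinder_preimage_comp (fun j => j.2.trans_le hN) hD

theorem IsCylinder.inter {N : ℕ} {S T : Set (ℕ → A)} (hS : IsCylinder L N S)
    (hT : IsCylinder L N T) : IsCylinder L N (S ∩ T) := by
  obtain ⟨D, hD, rfl⟩ := hS
  obtain ⟨E, hE, rfl⟩ := hT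
  exact ⟨_, hD.inter hE, rfl⟩

/-- Membership in a cylinder does not depend on the coordinates beyond its bound. -/
theorem IsCylinder.update_mem {N : ℕ} {S : Set (ℕ → A)} (hS : IsCylinder L N S) {v : ℕ → A}
    (hv : v ∈ S) {j : ℕ} (hj : N ≤ j) (c : A) : Function.update v j c ∈ S := by
  obtain ⟨D, hD, rfl⟩ := hS
  have : Function.update v j c ∘ (Fin.val : Fin N → ℕ) = v ∘ Fin.val := by
    funext i
    exact Function.update_of_ne (by have := i.2; omega) _ _
  simpa only [Set.mem_preimage, this] using hv

/-- Projections of cylinders to finitely many coordinates are definable, as the remaining relevant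
coordinates can be quantified away. -/
theorem IsCylinder.definable_image_comp [Nonempty A] {n N : ℕ} {S : Set (ℕ → A)}
    (hS : IsCylinder L N S) {t : Fin n → ℕ} (ht : ∀ j, t j < N) :
    (∅ : Set A).Definable L ((fun v : ℕ → A => v ∘ t) '' S) := by
  obtain ⟨D, hD, rfl⟩ := hS
  convert! hD.image_comp (fun j => (⟨t j, ht j⟩ : Fin N)) using 1
  have hsurj : Function.Surjective (fun v : ℕ → A => v ∘ (Fin.val : Fin N → ℕ)) :=
    Fin.val_injective.surjective_comp_right
  conv_rhs => rw [← Set.image_preimage_eq D hsurj, Set.image_image]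
  rfl

end Cylinders

/-! ### Omitting types -/

section OmittingTypes

variable (L : FirstOrder.Language.{u, v}) (A : Type w) [L.Structure A]

/-- The forcing conditions for omitting types: nonempty sets of sequences defined by a formula in
finitely many of the coordinates. -/
structure Condition where
  /-- The set of sequences admitted by the condition. -/
  carrier : Set (ℕ → A)
  nonempty : carrier.Nonempty
  isCylinder : ∃ N, IsCylinder L N carrier

/-- Larger conditions carry more information, that is, admit fewer sequences. -/
instance : Preorder (Condition L A) where
  le S T := T.carrier ⊆ S.carrier
  le_refl _ := subset_rfl
  le_trans _ _ _ h₁ h₂ := h₂.trans h₁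

variable {L A}

theorem realize_boundedFormula_definable {n : ℕ} (φ : L.BoundedFormula Empty n) :
    (∅ : Set A).Definable L {v : Fin n → A | φ.Realize default v} := by
  rw [Set.empty_definable_iff]
  refine ⟨φ.toFormula.relabel (Sum.elim Empty.elim id), ?_⟩
  ext v
  simp only [Set.mem_ofPred_eq, Formula.realize_relabel, BoundedFormula.realize_toFormula]
  congr! 1

variable (A) in
/-- The conditions that name a witness for `∃ y, φ(x_t, y)`, if there is one, by a coordinate. -/
def henkinConditions {n : ℕ} (φ : L.BoundedFormula Empty (n + 1)) (t : Fin n → ℕ) :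
    Order.Cofinal (Condition L A) where
  carrier := {S | ∃ j, ∀ v ∈ S.carrier, ∀ a, φ.Realize default (Fin.snoc (v ∘ t) a : _ → A) →
    φ.Realize default (Fin.snoc (v ∘ t) (v j) : _ → A)}
  isCofinal S := by
    obtain ⟨N, hN⟩ := S.isCylinder
    obtain ⟨v, hv⟩ := S.nonempty
    -- A coordinate `j` that is relevant neither to `S` nor to `t`.
    obtain ⟨j, hNj, hj⟩ : ∃ j, N ≤ j ∧ ∀ i, t i < j :=
      ⟨max N (Finset.univ.sup t + 1), le_max_left _ _, fun i =>
        lt_max_of_lt_right (Nat.lt_succ_of_le (Finset.le_sup (Finset.mem_univ i)))⟩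
    have hupd (c : A) : Function.update v j c ∘ t = v ∘ t :=
      funext fun i => Function.update_of_ne (hj i).ne _ _
    let D : Set (Fin n → A) := {x | φ.ex.Realize default x}
    let E : Set (Fin (n + 1) → A) := {x | φ.Realize default x}
    let s : Fin (n + 1) → ℕ := Fin.snoc t j
    have hs (u : ℕ → A) : u ∘ s = Fin.snoc (u ∘ t) (u j) := by
      funext i
      refine Fin.lastCases ?_ (fun i => ?_) i <;> simp [s]
    have hst (i) : s i < j + 1 := by
      refine Fin.lastCases ?_ (fun i => ?_) i
      · simp [s]
      · simpa [s] using (hj i).trans (Nat.lt_succ_self j)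
    let T : Set (ℕ → A) := (fun v => v ∘ t) ⁻¹' Dᶜ ∪ (fun v => v ∘ s) ⁻¹' E
    have hT : IsCylinder L (j + 1) T := by
      obtain ⟨X, hX, hX'⟩ := isCylinder_preimage_comp (L := L) (N := j + 1)
        (fun i => (hj i).trans (Nat.lt_succ_self j))
        (realize_boundedFormula_definable (A := A) φ.ex).compl
      obtain ⟨Y, hY, hY'⟩ := isCylinder_preimage_comp (L := L) hst
        (realize_boundedFormula_definable (A := A) φ)
      exact ⟨X ∪ Y, hX.union hY, by rw [Set.preimage_union, ← hX', ← hY']⟩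
    refine ⟨⟨S.carrier ∩ T, ?_, j + 1, (hN.mono (by omega)).inter hT⟩, ⟨j, ?_⟩,
      Set.inter_subset_left⟩
    · by_cases h : φ.ex.Realize default (v ∘ t)
      · obtain ⟨c, hc⟩ := BoundedFormula.realize_ex.1 h
        refine ⟨Function.update v j c, hN.update_mem hv hNj c, Or.inr ?_⟩
        simpa [E, hs, hupd] using hc
      · exact ⟨v, hv, Or.inl h⟩
    · rintro u ⟨-, hu⟩ a ha
      rcases hu with hu | hu
      · exact absurd (BoundedFormula.realize_ex.2 ⟨a, ha⟩) hu
      · simpa [E, hs] using hu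

/-- The conditions that force the subtuple with indices `t` not to realize the non-isolated
partial type `p`. -/
def omitConditions [Nonempty A] {n : ℕ} (p : Set (L.Formula (Fin n)))
    (hp : ∀ θ : L.Formula (Fin n), (∃ v : Fin n → A, θ.Realize v) →
      ∃ ψ ∈ p, ∃ v : Fin n → A, θ.Realize v ∧ ¬ ψ.Realize v) (t : Fin n → ℕ) :
    Order.Cofinal (Condition L A) where
  carrier := {S | ∃ ψ ∈ p, ∀ v ∈ S.carrier, ¬ ψ.Realize (v ∘ t)}
  isCofinal S := by
    obtain ⟨N₀, hN₀⟩ := S.isCylinder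
    obtain ⟨N, hN, ht⟩ : ∃ N, N₀ ≤ N ∧ ∀ i, t i < N :=
      ⟨max N₀ (Finset.univ.sup t + 1), le_max_left _ _, fun i =>
        lt_max_of_lt_right (Nat.lt_succ_of_le (Finset.le_sup (Finset.mem_univ i)))⟩
    obtain ⟨θ, hθ⟩ := Set.empty_definable_iff.1 ((hN₀.mono hN).definable_image_comp ht)
    obtain ⟨v₀, hv₀⟩ := S.nonempty
    obtain ⟨ψ, hψ, x, hx, hxψ⟩ := hp θ ⟨v₀ ∘ t, (Set.ext_iff.1 hθ _).1 ⟨v₀, hv₀, rfl⟩⟩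
    obtain ⟨v, hv, rfl⟩ := (Set.ext_iff.1 hθ x).2 hx
    have hdef : (∅ : Set A).Definable L {x : Fin n → A | ψ.Realize x} :=
      Set.empty_definable_iff.2 ⟨ψ, rfl⟩
    exact ⟨⟨S.carrier ∩ (fun v => v ∘ t) ⁻¹' {x | ψ.Realize x}ᶜ, ⟨v, hv, hxψ⟩, N,
      (hN₀.mono hN).inter (isCylinder_preimage_comp ht hdef.compl)⟩,
      ⟨ψ, hψ, fun u hu => hu.2⟩, Set.inter_subset_left⟩

/-- A family of conditions in an ideal is contained in a common ultrafilter on the set of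
sequences. -/
theorem exists_ultrafilter_of_ideal (I : Order.Ideal (Condition L A)) :
    ∃ U : Ultrafilter (ℕ → A), ∀ S ∈ I, S.carrier ∈ U := by
  have : Nonempty I := I.nonempty.to_subtype
  have hne : (⨅ S : I, Filter.principal S.1.carrier).NeBot := by
    refine Filter.iInf_neBot_of_directed' ?_ fun S => Filter.principal_neBot_iff.2 S.1.nonempty
    rintro ⟨S, hS⟩ ⟨T, hT⟩
    obtain ⟨R, hR, hSR, hTR⟩ := I.directed S hS T hT
    exact ⟨⟨R, hR⟩, Filter.principal_mono.2 hSR, Filter.principal_mono.2 hTR⟩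
  obtain ⟨U, hU⟩ := Ultrafilter.exists_le (⨅ S : I, Filter.principal S.1.carrier)
  exact ⟨U, fun S hS => hU (Filter.mem_iInf_of_mem ⟨S, hS⟩ (Filter.mem_principal_self _))⟩

/-- The class of a function in the ultrapower of `A` by the ultrafilter `U`. -/
def toUltrapower {X : Type w} (U : Ultrafilter X) (x : X → A) :
    (U : Filter X).Product fun _ => A :=
  Quotient.mk'' x

/-- Łoś's theorem for ultrapowers and formulas all of whose variables are numbered. -/
theorem realize_ultrapower_iff [Nonempty A] {X : Type w} (U : Ultrafilter X) {n : ℕ}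
    (φ : L.BoundedFormula Empty n) (x : Fin n → X → A) :
    φ.Realize default (fun i => toUltrapower U (x i)) ↔
      ∀ᶠ v in U, φ.Realize default fun i => x i v := by
  have h := Ultraproduct.boundedFormula_realize_cast (u := U) φ (fun e _ => e.elim) x
  have h₁ : (fun i : Empty => ((fun _ => i.elim : X → A) : (U : Filter X).Product fun _ => A)) =
      default := Subsingleton.elim _ _
  rw [h₁] at h
  exact h.trans (Filter.eventually_congr (Filter.Eventually.of_forall fun v => by
    rw [Subsingleton.elim (fun i : Empty => (i.elim : A)) default]))

theorem elementarilyEquivalent_ultrapower [Nonempty A] {X : Type w} (U : Ultrafilter X) :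
    L.ElementarilyEquivalent A ((U : Filter X).Product fun _ => A) :=
  elementarilyEquivalent_iff.2 fun φ =>
    ((Ultraproduct.sentence_realize φ).trans Filter.eventually_const).symm

variable (A) in
/-- The omitting types theorem for the complete theory of `A` and a single partial type. The
model omitting `p` consists of the coordinate functions in the ultrapower of `A` by a sufficiently
generic ultrafilter on `ℕ → A`. -/
theorem omitting_types [Countable L.Symbols] [Nonempty A] {n : ℕ} (p : Set (L.Formula (Fin n)))
    (hp : ∀ θ : L.Formula (Fin n), (∃ v : Fin n → A, θ.Realize v) →
      ∃ ψ ∈ p, ∃ v : Fin n → A, θ.Realize v ∧ ¬ ψ.Realize v) :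
    ∃ (C : Type w) (_ : L.Structure C), Countable C ∧ L.ElementarilyEquivalent A C ∧
      ∀ c : Fin n → C, ∃ ψ ∈ p, ¬ ψ.Realize c := by
  have hcount (n : ℕ) : Countable (L.BoundedFormula Empty n) :=
    (sigma_mk_injective (β := fun n => L.BoundedFormula Empty n) (i := n)).countable
  let ι := (Σ n, L.BoundedFormula Empty (n + 1) × (Fin n → ℕ)) ⊕ (Fin n → ℕ)
  let _ : Encodable ι := Encodable.ofCountable ι
  let 𝒟 : ι → Order.Cofinal (Condition L A) :=
    Sum.elim (fun x => henkinConditions A x.2.1 x.2.2) (omitConditions p hp)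
  let S₀ : Condition L A :=
    ⟨Set.univ, Set.univ_nonempty, 0, Set.univ, Set.definable_univ, rfl⟩
  obtain ⟨U, hU⟩ := exists_ultrafilter_of_ideal (Order.idealOfCofinals S₀ 𝒟)
  let M := (U : Filter (ℕ → A)).Product (fun _ => A)
  let g : ℕ → M := fun j => toUltrapower U fun v => v j
  have hg {n : ℕ} (φ : L.BoundedFormula Empty n) (t : Fin n → ℕ) :
      φ.Realize default (g ∘ t) ↔ ∀ᶠ v : ℕ → A in U, φ.Realize default (v ∘ t) :=
    realize_ultrapower_iff U φ fun i v => v (t i)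
  have hgs {n : ℕ} (t : Fin n → ℕ) (j : ℕ) :
      (Fin.snoc (g ∘ t) (g j) : Fin (n + 1) → M) = g ∘ (Fin.snoc t j : Fin (n + 1) → ℕ) := by
    rw [Fin.comp_snoc]
  have htv {n : ℕ} (φ : L.BoundedFormula Empty (n + 1)) (t : Fin n → ℕ) (a : M)
      (ha : φ.Realize default (Fin.snoc (g ∘ t) a : _ → M)) :
      ∃ j, φ.Realize default (Fin.snoc (g ∘ t) (g j) : _ → M) := by
    obtain ⟨a, rfl⟩ : ∃ x : (ℕ → A) → A, toUltrapower U x = a :=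
      Quotient.exists_rep a
    obtain ⟨S, ⟨j, hj⟩, hS⟩ := Order.cofinal_meets_idealOfCofinals S₀ 𝒟 (Sum.inl ⟨n, φ, t⟩)
    refine ⟨j, ?_⟩
    have hsnoc : (Fin.snoc (g ∘ t) (toUltrapower U a) : Fin (n + 1) → M) = fun i =>
        toUltrapower U ((Fin.snoc (fun i v => v (t i)) a : Fin (n + 1) → (ℕ → A) → A) i) := by
      funext i
      refine Fin.lastCases ?_ (fun i => ?_) i <;> simp [g]
    rw [hsnoc, realize_ultrapower_iff] at ha
    rw [hgs, hg]
    filter_upwards [ha, hU S hS] with v hv hvS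
    rw [Fin.comp_snoc]
    refine hj v hvS (a v) ?_
    convert! hv using 1
    funext i
    refine Fin.lastCases ?_ (fun i => ?_) i <;> simp
  let R : L.Substructure M :=
    { carrier := Set.range g
      fun_mem := by
        intro k f x hx
        choose t ht using hx
        obtain rfl : g ∘ t = x := funext ht
        let φ : L.BoundedFormula Empty (k + 1) :=
          Term.bdEqual (Term.func f fun i => Term.var (Sum.inr i.castSucc))
            (Term.var (Sum.inr (Fin.last k)))
        have hφ (y : M) : φ.Realize default (Fin.snoc (g ∘ t) y : _ → M) ↔
            Structure.funMap f (g ∘ t) = y := by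
          simp [φ, Function.comp_def]
        obtain ⟨j, hj⟩ := htv φ t _ ((hφ _).2 rfl)
        exact ⟨j, ((hφ _).1 hj).symm⟩ }
  let C : L.ElementarySubstructure M := R.toElementarySubstructure (by
    intro n φ x a ha
    choose t ht using fun i => (x i).2
    have hx : ((↑) ∘ x : Fin n → M) = g ∘ t := funext fun i => (ht i).symm
    rw [hx] at ha ⊢
    obtain ⟨j, hj⟩ := htv φ t a ha
    exact ⟨⟨g j, j, rfl⟩, hj⟩)
  refine ⟨C, inferInstance, (Set.countable_range g).to_subtype,
    (elementarilyEquivalent_ultrapower U).trans C.elementarilyEquivalent.symm, fun c => ?_⟩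
  choose t ht using fun i => (c i).2
  have hc : ((↑) ∘ c : Fin n → M) = g ∘ t := funext fun i => (ht i).symm
  obtain ⟨S, ⟨ψ, hψ, hSψ⟩, hS⟩ := Order.cofinal_meets_idealOfCofinals S₀ 𝒟 (Sum.inr t)
  refine ⟨ψ, hψ, fun h => ?_⟩
  have h' : ψ.Realize (g ∘ t) := by
    rw [← hc]
    exact (C.subtype.map_formula ψ c).2 h
  have h'' : ∀ᶠ v : ℕ → A in U, ψ.Realize (v ∘ t) :=
    (Ultraproduct.realize_formula_cast ψ fun i (v : ℕ → A) => v (t i)).1 h'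
  obtain ⟨v, hv, hvS⟩ := (h''.and (hU S hS)).exists
  exact hSψ v hvS hv

end OmittingTypes

/-! ### Finitely many definable sets -/

section RyllNardzewski

variable {L : FirstOrder.Language.{u, v}} {A : Type w} [L.Structure A]

/-- The type of an ultrafilter on `Aⁿ` is realized in a countable structure elementarily
equivalent to `A`: the identity realizes it in the ultrapower. -/
theorem exists_realization_of_ultrafilter [Countable L.Symbols] [Infinite A] {n : ℕ}
    (U : Ultrafilter (Fin n → A)) :
    ∃ (C : Type w) (_ : L.Structure C), Countable C ∧ L.ElementarilyEquivalent A C ∧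
      ∃ c : Fin n → C, ∀ ψ : L.Formula (Fin n), {v : Fin n → A | ψ.Realize v} ∈ U →
        ψ.Realize c := by
  let M := (U : Filter (Fin n → A)).Product (fun _ => A)
  let g : Fin n → M := fun j => toUltrapower U fun v => v j
  have hAM : L.ElementarilyEquivalent A M := elementarilyEquivalent_ultrapower U
  have hM : Infinite M := hAM.infinite_iff.1 ‹_›
  obtain ⟨C, hgC, hC⟩ := exists_elementarySubstructure_card_eq L (Set.range g) Cardinal.aleph0.{w}
    le_rfl (by simp)
    (by rw [Cardinal.lift_aleph0, Cardinal.lift_le_aleph0]; exact Cardinal.mk_le_aleph0)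
    (by simp)
  refine ⟨C, inferInstance, ?_, hAM.trans C.elementarilyEquivalent.symm,
    fun i => ⟨g i, hgC ⟨i, rfl⟩⟩, fun ψ hψ => ?_⟩
  · rw [← Cardinal.mk_le_aleph0_iff]
    simpa using hC.le
  · rw [← C.subtype.map_formula ψ]
    exact (Ultraproduct.realize_formula_cast ψ fun i (v : Fin n → A) => v i).2 hψ

variable (L A) in
/-- The filter of those sets whose complement meets the definable subsets of `Aⁿ` in only finitely
many different traces. If infinitely many subsets of `Aⁿ` are definable, this filter is proper, and
every ultrafilter above it gives a non-isolated type. -/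
def cofiniteTraceFilter (n : ℕ) : Filter (Fin n → A) where
  sets := {X | (Set.range fun φ : L.Formula (Fin n) => {v | φ.Realize v} \ X).Finite}
  univ_sets := by simp
  sets_of_superset {X Y} hX hXY := by
    refine (hX.image (· \ Y)).subset ?_
    rintro _ ⟨φ, rfl⟩
    refine ⟨_, ⟨φ, rfl⟩, ?_⟩
    change _ \ _ = _ \ _
    rw [Set.sdiff_sdiff, Set.union_eq_self_of_subset_left hXY]
  inter_sets {X Y} hX hY := by
    refine (hX.image2 (· ∪ ·) hY).subset ?_
    rintro _ ⟨φ, rfl⟩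
    exact ⟨_, ⟨φ, rfl⟩, _, ⟨φ, rfl⟩, Set.sdiff_inter.symm⟩

/-- The half of the Ryll-Nardzewski theorem that is needed here: in an `ℵ₀`-categorical
structure, only finitely many sets of `n`-tuples are definable without parameters. -/
theorem IsAleph0Categorical.finite_definable [Countable L.Symbols]
    (hA : IsAleph0Categorical L A) (n : ℕ) :
    (Set.range fun φ : L.Formula (Fin n) => {v : Fin n → A | φ.Realize v}).Finite := by
  by_contra hinf
  have : Infinite A := by
    by_contra hfin
    rw [not_infinite_iff_finite] at hfin
    exact hinf (Set.toFinite _)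
  have hF : (cofiniteTraceFilter L A n).NeBot := by
    rw [Filter.neBot_iff, ne_eq, ← Filter.empty_mem_iff_bot]
    intro h
    apply hinf
    simpa [cofiniteTraceFilter, ← Filter.mem_sets] using h
  obtain ⟨U, hU⟩ := Ultrafilter.exists_le (cofiniteTraceFilter L A n)
  let p : Set (L.Formula (Fin n)) := {ψ | {v : Fin n → A | ψ.Realize v} ∈ U}
  obtain ⟨C, _, hC, hAC, c, hc⟩ := exists_realization_of_ultrafilter (L := L) U
  obtain ⟨D, _, hD, hAD, hDp⟩ := omitting_types A p (by
    rintro θ ⟨v, hv⟩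
    by_contra! h
    -- If `θ` isolated `p`, the only traces on `θ` would be the empty and the full one.
    have hθU : {v : Fin n → A | θ.Realize v}ᶜ ∈ U := by
      refine hU ((Set.toFinite {∅, {v : Fin n → A | θ.Realize v}}).subset ?_)
      rintro _ ⟨χ, rfl⟩
      by_cases hχ : χ ∈ p
      · right
        ext x
        simpa using h χ hχ x
      · left
        have hχ' : ∼χ ∈ p := by
          change _ ∈ U
          rw [← Ultrafilter.compl_notMem_iff]
          simpa [Set.compl_def, p] using hχ
        ext x
        have := h _ hχ' x
        simp only [Formula.realize_not] at this
        simpa using fun h₁ h₂ => this h₂ h₁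
    exact (Formula.realize_not.1 (h (∼θ) (by simpa [p, Set.compl_def] using hθU) v hv)) hv)
  obtain ⟨eC⟩ := hA.2 C hC hAC
  obtain ⟨eD⟩ := hA.2 D hD hAD
  obtain ⟨ψ, hψ, hψD⟩ := hDp (eD ∘ eC.symm ∘ c)
  apply hψD
  rw [StrongHomClass.realize_formula eD, StrongHomClass.realize_formula eC.symm]
  exact hc ψ hψ

end RyllNardzewski
/-! ### Transfer of positive Horn formulas -/

section Transfer

variable {L : FirstOrder.Language.{u, v}} {A : Type w} {B : Type w'} [L.Structure A]
  [L.Structure B]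

/-- Up to equivalence in an `ℵ₀`-categorical structure, every set of formulas in `n` variables is
finite, and the finitely many representatives can be taken from the set itself. -/
theorem IsAleph0Categorical.exists_finite_representatives [Countable L.Symbols]
    (hA : IsAleph0Categorical L A) {n : ℕ} (Φ : Set (L.BoundedFormula Empty n)) :
    ∃ Ψ ⊆ Φ, Ψ.Finite ∧ ∀ φ ∈ Φ, ∃ ψ ∈ Ψ, ∀ v : Fin n → A,
      ψ.Realize default v ↔ φ.Realize default v := by
  let f : L.BoundedFormula Empty n → Set (Fin n → A) := fun φ => {v | φ.Realize default v}
  have hf : (f '' Φ).Finite := by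
    refine (hA.finite_definable n).subset ?_
    rintro _ ⟨φ, -, rfl⟩
    obtain ⟨ψ, hψ⟩ := Set.empty_definable_iff.1 (realize_boundedFormula_definable (A := A) φ)
    exact ⟨ψ, hψ.symm⟩
  obtain ⟨Ψ, hΨ, hbij⟩ := Set.exists_subset_bijOn Φ f
  refine ⟨Ψ, hΨ, Set.Finite.of_finite_image (hbij.image_eq ▸ hf) hbij.injOn, fun φ hφ => ?_⟩
  obtain ⟨ψ, hψ, h⟩ := hbij.surjOn (Set.mem_image_of_mem f hφ)
  exact ⟨ψ, hψ, Set.ext_iff.1 h⟩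

/-- The conjunction of a list of formulas. The empty conjunction is expressed by an equation, since
`⊤` is not literally a positive Horn formula. -/
def hornConj {n : ℕ} (l : List (L.BoundedFormula Empty (n + 1))) :
    L.BoundedFormula Empty (n + 1) :=
  l.foldr (· ⊓ ·) (Term.bdEqual (Term.var (Sum.inr 0)) (Term.var (Sum.inr 0)))

theorem isPositiveHorn_hornConj {n : ℕ} {l : List (L.BoundedFormula Empty (n + 1))}
    (hl : ∀ φ ∈ l, IsPositiveHorn φ) : IsPositiveHorn (hornConj l) := by
  induction l with
  | nil => exact .atomic (.equal _ _)
  | cons φ l ih =>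
    exact .inf (hl φ (by simp)) (ih fun ψ hψ => hl ψ (List.mem_cons_of_mem _ hψ))

theorem realize_hornConj {n : ℕ} {l : List (L.BoundedFormula Empty (n + 1))}
    {v : Fin (n + 1) → A} :
    (hornConj l).Realize default v ↔ ∀ φ ∈ l, φ.Realize default v := by
  induction l with
  | nil => simp [hornConj]
  | cons φ l ih => simpa [hornConj] using fun _ => ih

/-- Every positive Horn formula that holds of the tuple of sequences `a` at all coordinates holds
of the tuple `b`. For periodic sequences, the former means that it holds of `a` in the periodic
power. -/
def Transfers (L : FirstOrder.Language.{u, v}) {A : Type w} {B : Type w'} [L.Structure A]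
    [L.Structure B] {n : ℕ} (a : Fin n → ℕ → A) (b : Fin n → B) : Prop :=
  ∀ φ : L.BoundedFormula Empty n, IsPositiveHorn φ →
    (∀ i, φ.Realize default fun j => a j i) → φ.Realize default b

theorem snoc_apply_coordinate {n : ℕ} (a : Fin n → ℕ → A) (x : ℕ → A) (i : ℕ) :
    (fun j => (Fin.snoc a x : Fin (n + 1) → ℕ → A) j i) =
      (Fin.snoc (fun j => a j i) (x i) : Fin (n + 1) → A) := by
  funext j
  refine Fin.lastCases ?_ (fun j => ?_) j <;> simp

/-- The forth step: the positive Horn formulas to be satisfied by the new element of `B` amount to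
a single one, which can be quantified existentially. -/
theorem Transfers.exists_snoc_right [Countable L.Symbols] (hB : IsAleph0Categorical L B) {n : ℕ}
    {a : Fin n → ℕ → A} {b : Fin n → B} (h : Transfers L a b) (x : ℕ → A) :
    ∃ y : B, Transfers L (Fin.snoc a x : Fin (n + 1) → ℕ → A) (Fin.snoc b y : Fin (n + 1) → B) := by
  obtain ⟨Ψ, hΨ, hfin, hrep⟩ := hB.exists_finite_representatives
    {φ : L.BoundedFormula Empty (n + 1) | IsPositiveHorn φ ∧
      ∀ i, φ.Realize default fun j => (Fin.snoc a x : Fin (n + 1) → ℕ → A) j i}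
  have hl (φ) : φ ∈ hfin.toFinset.toList ↔ φ ∈ Ψ := by simp
  have hconj := h (hornConj hfin.toFinset.toList).ex
    (isPositiveHorn_hornConj fun φ hφ => (hΨ ((hl φ).1 hφ)).1).ex fun i => by
      refine BoundedFormula.realize_ex.2 ⟨x i, realize_hornConj.2 fun φ hφ => ?_⟩
      rw [← snoc_apply_coordinate]
      exact (hΨ ((hl φ).1 hφ)).2 i
  obtain ⟨y, hy⟩ := BoundedFormula.realize_ex.1 hconj
  refine ⟨y, fun φ hφ hreal => ?_⟩
  obtain ⟨ψ, hψ, hψφ⟩ := hrep φ ⟨hφ, hreal⟩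
  exact (hψφ _).1 (realize_hornConj.1 hy ψ ((hl ψ).2 hψ))

theorem exists_common_period {n : ℕ} {a : Fin n → ℕ → A} (ha : ∀ j, IsPeriodic (a j)) :
    ∃ k, 0 < k ∧ ∀ j, IsPeriodicWith (a j) k := by
  choose k hk using ha
  have hpos : 0 < ∏ j, k j := Finset.prod_pos fun j _ => (hk j).1
  exact ⟨∏ j, k j, hpos, fun j => (hk j).of_dvd hpos (Finset.dvd_prod_of_mem k (Finset.mem_univ j))⟩

/-- The back step: the positive Horn formulas that fail for the new tuple in `B` fall into finitely
many classes over `A`. Each class can be falsified at some coordinate, and periodicity of `a` makes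
it possible to use distinct coordinates for distinct classes. -/
theorem Transfers.exists_snoc_left [Countable L.Symbols] (hA : IsAleph0Categorical L A) {n : ℕ}
    {a : Fin n → ℕ → A} {b : Fin n → B} (ha : ∀ j, IsPeriodic (a j)) (h : Transfers L a b)
    (y : B) :
    ∃ x : ℕ → A, IsPeriodic x ∧
      Transfers L (Fin.snoc a x : Fin (n + 1) → ℕ → A) (Fin.snoc b y : Fin (n + 1) → B) := by
  obtain ⟨Ψ, hΨ, hfin, hrep⟩ := hA.exists_finite_representatives
    {φ : L.BoundedFormula Empty (n + 1) | IsPositiveHorn φ ∧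
      ¬ φ.Realize default (Fin.snoc b y : Fin (n + 1) → B)}
  obtain ⟨k, hk, hak⟩ := exists_common_period ha
  have hfalse (ψ : Ψ) : ∃ (i : ℕ) (c : A),
      ¬ ψ.1.Realize default (Fin.snoc (fun j => a j i) c : Fin (n + 1) → A) := by
    by_contra! hall
    refine (hΨ ψ.2).2 (BoundedFormula.realize_all.1 (h ψ.1.all (hΨ ψ.2).1.all fun i => ?_) y)
    exact BoundedFormula.realize_all.2 (hall i)
  choose pos c hc using hfalse
  have : Finite Ψ := hfin
  let m := Nat.card Ψ
  let e : Ψ ≃ Fin m := Finite.equivFin Ψ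
  have hm : 0 < m := by
    -- `⊥` is a positive Horn formula that fails in `B`.
    obtain ⟨ψ, hψ, -⟩ := hrep ⊥ ⟨.falsum, by simp⟩
    exact (e ⟨ψ, hψ⟩).pos
  have hlt (i : ℕ) : i % (k * m) / k < m :=
    Nat.div_lt_of_lt_mul (Nat.mod_lt _ (Nat.mul_pos hk hm))
  -- The `r`-th block of length `k` in each period is reserved for the `r`-th class of formulas.
  let x : ℕ → A := fun i => c (e.symm ⟨i % (k * m) / k, hlt i⟩)
  refine ⟨x, ⟨k * m, Nat.mul_pos hk hm, fun i => by simp [x]⟩, fun φ hφ hreal => ?_⟩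
  by_contra hnot
  obtain ⟨ψ, hψ, hψφ⟩ := hrep φ ⟨hφ, hnot⟩
  let r := e ⟨ψ, hψ⟩
  let i := k * r + pos ⟨ψ, hψ⟩ % k
  have hmod : pos ⟨ψ, hψ⟩ % k < k := Nat.mod_lt _ hk
  have hi : i % (k * m) / k = r := by
    have : i < k * m := calc
      i < k * r + k := Nat.add_lt_add_left hmod _
      _ = k * (r + 1) := by ring
      _ ≤ k * m := Nat.mul_le_mul_left _ r.2
    rw [Nat.mod_eq_of_lt this, Nat.mul_add_div hk, Nat.div_eq_of_lt hmod, add_zero]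
  have hx : x i = c ⟨ψ, hψ⟩ := by
    simp only [x, hi, Fin.eta, r, Equiv.symm_apply_apply]
  have hai (j) : a j i = a j (pos ⟨ψ, hψ⟩) := by
    rw [(hak j).2 i, (hak j).2 (pos _)]
    simp [i]
  refine hc ⟨ψ, hψ⟩ ((hψφ _).2 ?_)
  have := hreal i
  rw [snoc_apply_coordinate, hx] at this
  simpa only [hai] using this

end Transfer

/-! ### The finite parts of the homomorphism -/

section BackAndForth

variable {L : FirstOrder.Language.{u, v}} {A : Type w} {B : Type w'} [L.Structure A]
  [L.Structure B]

instance countable_periodicPower [Countable A] : Countable (periodicPower L A) := by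
  let f : (Σ k, Fin (k + 1) → A) → periodicPower L A := fun x =>
    ⟨fun i => x.2 ⟨i % (x.1 + 1), Nat.mod_lt _ x.1.succ_pos⟩, x.1 + 1, x.1.succ_pos, by simp⟩
  refine Function.Surjective.countable (f := f) ?_
  rintro ⟨a, k, hk, ha⟩
  obtain ⟨k, rfl⟩ := Nat.exists_eq_succ_of_ne_zero hk.ne'
  exact ⟨⟨k, fun i => a i⟩, Subtype.ext (funext fun i => (ha i).symm)⟩

variable (L A B) in
/-- A finite piece of the homomorphism under construction: a tuple in the periodic power and a
tuple of images. -/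
structure FinitePart where
  /-- The length of the tuples. -/
  n : ℕ
  /-- The tuple in the periodic power. -/
  a : Fin n → periodicPower L A
  /-- The tuple of images. -/
  b : Fin n → B
  transfers : Transfers L (fun j => (a j : ℕ → A)) b

/-- Extension of finite parts: the smaller one consists of entries of the larger one. -/
instance : Preorder (FinitePart L A B) where
  le s t := ∃ f : Fin s.n → Fin t.n, t.a ∘ f = s.a ∧ t.b ∘ f = s.b
  le_refl s := ⟨id, rfl, rfl⟩
  le_trans := by
    rintro s t r ⟨f, hfa, hfb⟩ ⟨g, hga, hgb⟩
    exact ⟨g ∘ f, by rw [← Function.comp_assoc, hga, hfa],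
      by rw [← Function.comp_assoc, hgb, hfb]⟩

/-- The finite parts that map `x` to `y`. -/
def FinitePart.Maps (s : FinitePart L A B) (x : periodicPower L A) (y : B) : Prop :=
  ∃ j, s.a j = x ∧ s.b j = y

theorem FinitePart.Maps.mono {s t : FinitePart L A B} {x : periodicPower L A} {y : B}
    (h : s.Maps x y) (hst : s ≤ t) : t.Maps x y := by
  obtain ⟨j, rfl, rfl⟩ := h
  obtain ⟨f, hfa, hfb⟩ := hst
  exact ⟨f j, congrFun hfa j, congrFun hfb j⟩

theorem FinitePart.exists_extension (s : FinitePart L A B) {x : periodicPower L A} {y : B}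
    (h : Transfers L (Fin.snoc (fun j => (s.a j : ℕ → A)) x : Fin (s.n + 1) → ℕ → A)
      (Fin.snoc s.b y : Fin (s.n + 1) → B)) :
    ∃ t, t.Maps x y ∧ s ≤ t := by
  refine ⟨⟨s.n + 1, Fin.snoc s.a x, Fin.snoc s.b y, ?_⟩, ⟨Fin.last _, by simp, by simp⟩,
    Fin.castSucc, by funext j; simp, by funext j; simp⟩
  convert! h using 1
  funext j
  refine Fin.lastCases ?_ (fun j => ?_) j <;> simp

/-- Relations among entries of a finite part are preserved, because atomic formulas are positive
Horn. -/
theorem FinitePart.relMap (s : FinitePart L A B) {k : ℕ} (R : L.Relations k)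
    {x : Fin k → periodicPower L A} {y : Fin k → B} (h : ∀ i, s.Maps (x i) (y i))
    (hR : Structure.RelMap R x) : Structure.RelMap R y := by
  choose t hx hy using h
  obtain rfl : s.a ∘ t = x := funext hx
  obtain rfl : s.b ∘ t = y := funext hy
  have := s.transfers (R.boundedFormula fun i => Term.var (Sum.inr (t i)))
    (.atomic (.rel _ _)) fun i => BoundedFormula.realize_rel.2 (hR i)
  exact BoundedFormula.realize_rel.1 this

theorem FinitePart.funMap (s : FinitePart L A B) {k : ℕ} (f : L.Functions k)
    {x : Fin k → periodicPower L A} {y : Fin k → B} {z : B} (h : ∀ i, s.Maps (x i) (y i))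
    (hf : s.Maps (Structure.funMap f x) z) : z = Structure.funMap f y := by
  choose t hx hy using h
  obtain rfl : s.a ∘ t = x := funext hx
  obtain rfl : s.b ∘ t = y := funext hy
  obtain ⟨j, hj, rfl⟩ := hf
  have := s.transfers (Term.bdEqual (Term.var (Sum.inr j))
      (Term.func f fun i => Term.var (Sum.inr (t i))))
    (.atomic (.equal _ _)) fun i => (BoundedFormula.realize_bdEqual _ _).2
      (congrFun (congrArg Subtype.val hj) i)
  exact (BoundedFormula.realize_bdEqual _ _).1 this

theorem FinitePart.maps_unique {s : FinitePart L A B} {x : periodicPower L A} {y z : B}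
    (hy : s.Maps x y) (hz : s.Maps x z) : y = z := by
  obtain ⟨i, rfl, rfl⟩ := hy
  obtain ⟨j, hj, rfl⟩ := hz
  have := s.transfers (Term.bdEqual (Term.var (Sum.inr i)) (Term.var (Sum.inr j)))
    (.atomic (.equal _ _)) fun l => (BoundedFormula.realize_bdEqual _ _).2
      (congrFun (congrArg Subtype.val hj.symm) l)
  exact (BoundedFormula.realize_bdEqual _ _).1 this

/-- The finite parts defined at `x`, by the forth step. -/
def FinitePart.definedAt [Countable L.Symbols] (hB : IsAleph0Categorical L B)
    (x : periodicPower L A) : Order.Cofinal (FinitePart L A B) where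
  carrier := {s | ∃ y, s.Maps x y}
  isCofinal s := by
    obtain ⟨y, hy⟩ := s.transfers.exists_snoc_right hB x
    obtain ⟨t, ht, hst⟩ := s.exists_extension hy
    exact ⟨t, ⟨y, ht⟩, hst⟩

/-- The finite parts that attain `y`, by the back step. -/
def FinitePart.attaining [Countable L.Symbols] (hA : IsAleph0Categorical L A) (y : B) :
    Order.Cofinal (FinitePart L A B) where
  carrier := {s | ∃ x, s.Maps x y}
  isCofinal s := by
    obtain ⟨x, hx, hxy⟩ := s.transfers.exists_snoc_left hA (fun j => (s.a j).2) y
    obtain ⟨t, ht, hst⟩ := s.exists_extension (x := ⟨x, hx⟩) hxy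
    exact ⟨t, ⟨_, ht⟩, hst⟩

end BackAndForth
end PeriodicPower

/-! ### The surjective homomorphism -/

open PeriodicPower

theorem lemma6p3 (L : FirstOrder.Language.{u, v}) [Countable L.Symbols]
    (A : Type w) (B : Type w') [L.Structure A] [L.Structure B]
    (hA : PeriodicPower.IsAleph0Categorical L A) (hB : PeriodicPower.IsAleph0Categorical L B)
    (hAB : PeriodicPower.PositiveHornTransfer L A B) :
    ∃ h : PeriodicPower.periodicPower L A →[L] B, Function.Surjective h := by
  have := hA.1
  have := hB.1
  let _ : Encodable (periodicPower L A ⊕ B) := Encodable.ofCountable _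
  let 𝒟 : periodicPower L A ⊕ B → Order.Cofinal (FinitePart L A B) :=
    Sum.elim (FinitePart.definedAt hB) (FinitePart.attaining hA)
  let s₀ : FinitePart L A B := ⟨0, Fin.elim0, Fin.elim0, fun φ hφ h => by
    have hφA : A ⊨ φ := by
      rw [Sentence.Realize, Formula.Realize]
      convert! h 0
    have hφB := hAB φ hφ hφA
    rw [Sentence.Realize, Formula.Realize] at hφB
    convert! hφB⟩
  let I := Order.idealOfCofinals s₀ 𝒟
  have hdef (x : periodicPower L A) : ∃ y, ∃ s ∈ I, s.Maps x y := by
    obtain ⟨s, ⟨y, hy⟩, hs⟩ := Order.cofinal_meets_idealOfCofinals s₀ 𝒟 (Sum.inl x)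
    exact ⟨y, s, hs, hy⟩
  choose h s hs hsh using hdef
  have : Nonempty I := I.nonempty.to_subtype
  -- Finitely many values of `h` are given by a single finite part in the ideal.
  have hub {k : ℕ} (x : Fin k → periodicPower L A) :
      ∃ t ∈ I, ∀ i, t.Maps (x i) (h (x i)) := by
    obtain ⟨t, ht⟩ := (directedOn_iff_directed.1 I.directed).finite_le
      (fun i => (⟨s (x i), hs (x i)⟩ : I))
    exact ⟨t, t.2, fun i => (hsh (x i)).mono (ht i)⟩
  refine ⟨⟨h, fun {k} f x => ?_, fun {k} R x hR => ?_⟩, fun y => ?_⟩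
  · obtain ⟨t, ht, htx⟩ := hub x
    obtain ⟨r, -, hr₁, hr₂⟩ := I.directed t ht _ (hs (Structure.funMap f x))
    exact r.funMap f (fun i => (htx i).mono hr₁) ((hsh _).mono hr₂)
  · obtain ⟨t, -, htx⟩ := hub x
    exact t.relMap R htx hR
  · obtain ⟨t, ⟨x, hx⟩, ht⟩ := Order.cofinal_meets_idealOfCofinals s₀ 𝒟 (Sum.inr y)
    obtain ⟨r, -, hr₁, hr₂⟩ := I.directed t ht _ (hs x)
    exact ⟨x, FinitePart.maps_unique ((hsh x).mono hr₂) (hx.mono hr₁)⟩
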